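/- Let $\mathbb F$ be an infinite field of arbitrary characteristic $p\ge 0$ and let $\mathcal Q=(\mathcal Q_0,\mathcal Q_1)$ be a quiver (a finite oriented graph); $a'$ and $a''$ denote the head and the tail of an arrow $a$, and $a_1\cdots a_r$ is a path if $a_1''=a_2',\dots,a_{r-1}''=a_r'$; it is closed if $a_1'=a_r''$. Let $\mathbf i:\mathcal Q_0\to\mathcal Q_0$ be an involution with $\mathbf i(v)\ne v$ for every vertex $v$. A dimension vector $\mathbf n=(\mathbf n_v)_{v\in\mathcal Q_0}$ is always assumed to satisfy $\mathbf n_{\mathbf i(v)}=\mathbf n_v$. The double quiver $\mathcal Q^{D}$ has vertices $\mathcal Q_0$ and arrows $a,a^T$ $(a\in\mathcal Q_1)$, where $(a^T)'=\mathbf i(a'')$ and $(a^T)''=\mathbf i(a')$. For a closed path $a=a_1\cdots a_r$ $(r\geq 1)$ in $\mathcal Q^D$ put $a^T=a_r^T\cdots a_1^T$, where $(b^T)^T=b$. Write $a\sim b$ if $b$ or $b^T$ is a cyclic permutation of $a$, and call $a$ primitive if it is not a power of a shorter closed path. Let $\mathcal N_\sigma(\mathcal Q,\mathbf i)$ be the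 commutative polynomial ring over $\mathbb F$ freely generated by symbols $\sigma_t(a)$, where $t>0$ and $a$ ranges over the $\sim$-classes of primitive closed paths in $\mathcal Q^D$. For a dimension vector $\mathbf n$ let $R=\mathbb F[x^a_{ij}\mid a\in\mathcal Q_1,\ 1\le i\le \mathbf n_{a'},\ 1\le j\le \mathbf n_{a''}]$, let $X_a=(x^a_{ij})$ be the generic matrices, $X_{a^T}=X_a^T$, and $X_{a_1\cdots a_r}=X_{a_1}\cdots X_{a_r}$. Let $GL(\mathbf n,\mathbf i)$ be the group of all $(g_v)\in\prod_v GL(\mathbf n_v)$ with $g_vg_{\mathbf i(v)}^T=E$ for all $v$; it acts on $R$ by sending $x_{ij}^a$ to the $(i,j)$ entry of $g_{a'}^{-1}X_ag_{a''}$. Let $I(\mathcal Q,\mathbf n,\mathbf i)=R^{GL(\mathbf n,\mathbf i)}$. With $\det(X+\lambda E)=\sum_{t=0}^m\lambda^{m-t}\sigma_t(X)$ for an $m\times m$ matrix $X$, let $\Upsilon_{\mathbf n}:\mathcal N_\sigma(\mathcal Q,\mathbf i)\to I(\mathcal Q,\mathbf n,\mathbf i)$ be the homomorphism of $\mathbb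 F$-algebras with $\sigma_t(a)\mapsto\sigma_t(X_a)$ if $t\le\mathbf n_{a'}$ and $\sigma_t(a)\mapsto 0$ otherwise, and let $K_{\mathbf n}(\mathcal Q,\mathbf i)=\ker\Upsilon_{\mathbf n}$. **Lemma.** The ideal of free relations $K(\mathcal Q,\mathbf i)=\bigcap_{\mathbf m}K_{\mathbf m}(\mathcal Q,\mathbf i)$, where $\mathbf m$ ranges over all dimension vectors with $\mathbf m_v>0$ and $\mathbf m_{\mathbf i(v)}=\mathbf m_v$ for all $v\in\mathcal Q_0$, is zero. -/

import Mathlib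

open Matrix Polynomial

namespace MixedQuiver

set_option linter.unusedSectionVars false

section Words

variable {V : Type*} [Quiver V]

/-- The arrows of a quiver.  For `a : Arrow V` the head is `a.right` and the tail is `a.left`. -/
abbrev Arrow (V : Type*) [Quiver V] := Quiver.Total V

/-- The arrows of the double quiver: `Sum.inl a` is the arrow `a` itself and `Sum.inr a` is the
additional arrow `aᵀ`. -/
abbrev DArrow (V : Type*) [Quiver V] := Arrow V ⊕ Arrow V

/-- The head of an arrow of the double quiver: `aᵀ` has head `i (tail a)`. -/
def DArrow.head (i : V → V) : DArrow V → V
  | Sum.inl a => a.right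
  | Sum.inr a => i a.left

/-- The tail of an arrow of the double quiver: `aᵀ` has tail `i (head a)`. -/
def DArrow.tail (i : V → V) : DArrow V → V
  | Sum.inl a => a.left
  | Sum.inr a => i a.right

/-- `IsPath i u w v`: the word `w = a₁ ⋯ aᵣ` is a path in the double quiver with head `u` and
tail `v`, i.e. the head of `a₁` is `u`, the tail of each letter is the head of the next one,
and the tail of `aᵣ` is `v`. -/
def IsPath (i : V → V) : V → List (DArrow V) → V → Prop
  | u, [], v => u = v
  | u, a :: w, v => DArrow.head i a = u ∧ IsPath i (DArrow.tail i a) w v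

/-- The transpose `(a₁ ⋯ aᵣ)ᵀ = aᵣᵀ ⋯ a₁ᵀ` of a word, where `(aᵀ)ᵀ = a` for a letter. -/
def wordTranspose (w : List (DArrow V)) : List (DArrow V) := (w.map Sum.swap).reverse

/-- Closed paths (of positive length) in the double quiver. The vertex is the common value of
the head and the tail of the path. -/
structure ClosedPath (i : V → V) where
  word : List (DArrow V)
  vertex : V
  ne_nil : word ≠ []
  isPath : IsPath i vertex word vertex

/-- A closed path is primitive if it is not a power of a shorter closed path. -/
def ClosedPath.IsPrimitive {i : V → V} (a : ClosedPath i) : Prop :=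
  ¬ ∃ (b : ClosedPath i) (k : ℕ), b.word.length < a.word.length ∧
    a.word = (List.replicate k b.word).flatten

/-- The set of primitive closed paths in the double quiver. -/
abbrev PrimPath (i : V → V) := {a : ClosedPath i // a.IsPrimitive}

/-- `a ∼ b` for closed paths: `b` or `bᵀ` is a cyclic permutation of `a`. -/
def ClosedPath.Equivalent {i : V → V} (a b : ClosedPath i) : Prop :=
  a.word ~r b.word ∨ a.word ~r wordTranspose b.word

theorem wordTranspose_wordTranspose (w : List (DArrow V)) :
    wordTranspose (wordTranspose w) = w := by
  simp [wordTranspose]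

theorem isRotated_wordTranspose {w z : List (DArrow V)} (h : w ~r z) :
    wordTranspose w ~r wordTranspose z :=
  (h.map _).reverse

/-- The equivalence `∼` on primitive closed paths. -/
def primSetoid (i : V → V) : Setoid (PrimPath i) where
  r a b := a.1.Equivalent b.1
  iseqv :=
    { refl := fun a => Or.inl (List.IsRotated.refl _)
      symm := by
        rintro a b (h | h)
        · exact Or.inl h.symm
        · refine Or.inr ?_
          have := isRotated_wordTranspose h
          rw [wordTranspose_wordTranspose] at this
          exact this.symm
      trans := by
        rintro a b c (h | h) (h' | h')
        · exact Or.inl (h.trans h')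
        · exact Or.inr (h.trans h')
        · exact Or.inr (h.trans (isRotated_wordTranspose h'))
        · refine Or.inl (h.trans ?_)
          have := isRotated_wordTranspose h'
          rwa [wordTranspose_wordTranspose] at this }

/-- The polynomial ring over `F` freely generated by the symbols `σ_t(a)`, where `t > 0` and `a`
ranges over the `∼`-classes of primitive closed paths in the double quiver. -/
abbrev NSigma (F : Type*) [CommSemiring F] (i : V → V) :=
  MvPolynomial (ℕ+ × Quotient (primSetoid i)) F

/-- Dimension vectors `n` with `n (i v) = n v` for all vertices `v`. -/
structure DimVector (i : V → V) where
  dim : V → ℕ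
  dim_inv : ∀ v, dim (i v) = dim v

theorem isPath_append {i : V → V} {w z : List (DArrow V)} {u v : V} :
    IsPath i u (w ++ z) v ↔ ∃ x, IsPath i u w x ∧ IsPath i x z v := by
  induction w generalizing u with
  | nil => simp [IsPath]
  | cons a w ih => simp [IsPath, ih, and_assoc]

theorem isPath_unique {i : V → V} {w : List (DArrow V)} {u v u' v' : V} (hw : w ≠ [])
    (h : IsPath i u w v) (h' : IsPath i u' w v') : u = u' ∧ v = v' := by
  induction w generalizing u u' with
  | nil => exact absurd rfl hw
  | cons a w ih =>
    refine ⟨h.1.symm.trans h'.1, ?_⟩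
    cases w with
    | nil => exact h.2.symm.trans h'.2
    | cons b w => exact (ih (by simp) h.2 h'.2).2

theorem isPath_wordTranspose {i : V → V} (hi : Function.Involutive i) {w : List (DArrow V)}
    {u v : V} (h : IsPath i u w v) : IsPath i (i v) (wordTranspose w) (i u) := by
  induction w generalizing u with
  | nil => exact congrArg i (show u = v from h).symm
  | cons a w ih =>
    have h2 := ih h.2
    have : wordTranspose (a :: w) = wordTranspose w ++ [Sum.swap a] := by
      simp [wordTranspose]
    rw [this, isPath_append]
    refine ⟨_, h2, ?_⟩
    obtain ⟨h1, -⟩ := h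
    subst h1
    cases a <;> simp [IsPath, DArrow.head, DArrow.tail, hi _]

end Words

section Sigma

variable {S : Type*} [CommRing S] {k : ℕ}

/-- `σ_t(M)` for a `k × k` matrix `M` and `t ≤ k`: the coefficient of `λ^(k-t)` in
`det (M + λ E)`. -/
noncomputable def sigma (t : ℕ) (M : Matrix (Fin k) (Fin k) S) : S :=
  (Matrix.det (M.map Polynomial.C + (Polynomial.X : S[X]) • 1)).coeff (k - t)

theorem sigma_ite [Nontrivial S] (t : ℕ) (M : Matrix (Fin k) (Fin k) S) :
    (if t ≤ k then sigma t M else 0) =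
      (Matrix.det (1 + (Polynomial.X : S[X]) • M.map Polynomial.C)).coeff t := by
  have h1 : Matrix.det (M.map Polynomial.C + (Polynomial.X : S[X]) • 1) = (-M).charpoly := by
    rw [Matrix.charpoly, Matrix.charmatrix]
    congr 1
    ext a b
    simp [Matrix.smul_one_eq_diagonal, add_comm]
  have h2 : Matrix.det (1 + (Polynomial.X : S[X]) • M.map Polynomial.C) =
      (-M).charpolyRev := by
    rw [Matrix.charpolyRev]
    congr 1
    ext a b
    simp
  rw [h2, ← Matrix.reverse_charpoly, Polynomial.coeff_reverse, Matrix.charpoly_natDegree_eq_dim,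
    Fintype.card_fin, sigma, h1]
  split_ifs with h
  · rw [Polynomial.revAt_le h]
  · rw [Polynomial.revAt_eq_self_of_lt (by omega)]
    rw [Polynomial.coeff_eq_zero_of_natDegree_lt]
    rw [Matrix.charpoly_natDegree_eq_dim, Fintype.card_fin]; omega

theorem det_transpose_submatrix {l : ℕ} (e : Fin l ≃ Fin k) (M : Matrix (Fin k) (Fin k) S) :
    Matrix.det (1 + (Polynomial.X : S[X]) • (Mᵀ.submatrix e e).map Polynomial.C) =
      Matrix.det (1 + (Polynomial.X : S[X]) • M.map Polynomial.C) := by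
  rw [← Matrix.det_transpose (1 + (Polynomial.X : S[X]) • M.map Polynomial.C),
    ← Matrix.det_submatrix_equiv_self e (Matrix.transpose _)]
  congr 1
  ext1 r s
  simp [Matrix.one_apply]

end Sigma

section Invariants

theorem mul_mul_mul_eq_one {S : Type*} [Semiring S] {a b c d : S} (h1 : a * d = 1)
    (h2 : b * c = 1) : a * b * (c * d) = 1 := by
  rw [mul_assoc, ← mul_assoc b, h2, one_mul, h1]

theorem mul_one_submatrix {S : Type*} [Semiring S] {a b c : ℕ} (M : Matrix (Fin a) (Fin b) S)
    (e : Fin c → Fin b) :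
    M * (1 : Matrix (Fin b) (Fin b) S).submatrix id e = M.submatrix id e := by
  ext r s
  simp [Matrix.mul_apply, Matrix.one_apply]

variable (F : Type*) [Field F] {V : Type*} [Quiver V] {i : V → V}

/-- The coordinate ring of the space of representations of dimension `n`: polynomials in the
variables `x_{rs}^a`, where `a` is an arrow, `r ≤ n (head a)` and `s ≤ n (tail a)`. -/
abbrev CoordRing (n : DimVector i) :=
  MvPolynomial (Σ a : Arrow V, Fin (n.dim a.right) × Fin (n.dim a.left)) F

/-- The generic matrix of an arrow. -/
noncomputable def genericMatrix (n : DimVector i) (a : Arrow V) :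
    Matrix (Fin (n.dim a.right)) (Fin (n.dim a.left)) (CoordRing F n) :=
  Matrix.of fun r s => MvPolynomial.X ⟨a, r, s⟩

/-- The matrix of an arrow of the double quiver; for `aᵀ` it is the transpose of the generic
matrix of `a`, where rows and columns are indexed by means of `n (i v) = n v`. -/
noncomputable def letterMatrix (n : DimVector i) : (a : DArrow V) →
    Matrix (Fin (n.dim (DArrow.head i a))) (Fin (n.dim (DArrow.tail i a))) (CoordRing F n)
  | Sum.inl a => genericMatrix F n a
  | Sum.inr a => (genericMatrix F n a)ᵀ.submatrix
      (finCongr (n.dim_inv a.left)) (finCongr (n.dim_inv a.right))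

/-- The product `X_{a₁} ⋯ X_{aᵣ}` of the matrices of the letters of a path. -/
noncomputable def pathMatrix (n : DimVector i) : (u : V) → (w : List (DArrow V)) → (v : V) →
    IsPath i u w v → Matrix (Fin (n.dim u)) (Fin (n.dim v)) (CoordRing F n)
  | _, [], _, h => (1 : Matrix _ _ (CoordRing F n)).submatrix id
      (finCongr (congrArg n.dim (Eq.symm h)))
  | _, a :: w, v, h => (letterMatrix F n a).submatrix
      (finCongr (congrArg n.dim h.1.symm)) id * pathMatrix n (DArrow.tail i a) w v h.2

/-- The group `GL(n, i)` of all families `(g_v)` with `g_v g_{i(v)}ᵀ = E` for all `v`. -/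
def GLn (n : DimVector i) : Subgroup (∀ v : V, GL (Fin (n.dim v)) F) where
  carrier := {g | ∀ v, (g v : Matrix _ _ F) *
    ((g (i v) : Matrix _ _ F)ᵀ.submatrix (finCongr (n.dim_inv v).symm)
      (finCongr (n.dim_inv v).symm)) = 1}
  one_mem' := by
    intro v
    simp
  mul_mem' := by
    intro g h hg hh v
    have h1 := hg v
    have h2 := hh v
    simp only [Pi.mul_apply, Units.val_mul, Matrix.transpose_mul]
    rw [← Matrix.submatrix_mul_equiv _ _ _ (finCongr (n.dim_inv v).symm)]
    exact mul_mul_mul_eq_one h1 h2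
  inv_mem' := by
    intro g hg v
    have h1 := hg v
    set e := finCongr (n.dim_inv v).symm
    have h2 : ((g (i v) : Matrix _ _ F)ᵀ.submatrix e e) *
        (((g⁻¹) (i v) : Matrix _ _ F)ᵀ.submatrix e e) = 1 := by
      rw [Matrix.submatrix_mul_equiv, ← Matrix.transpose_mul, Pi.inv_apply, Units.inv_mul]
      simp
    have h3 : ((g⁻¹) v : Matrix _ _ F) = ((g (i v) : Matrix _ _ F)ᵀ.submatrix e e) := by
      rw [Pi.inv_apply, Units.inv_eq_of_mul_eq_one_right h1]
    rw [h3, h2]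

variable {F} in
/-- A matrix over `F`, considered as a matrix over the coordinate ring. -/
noncomputable def constMatrix (n : DimVector i) {k : ℕ} (M : Matrix (Fin k) (Fin k) F) :
    Matrix (Fin k) (Fin k) (CoordRing F n) :=
  M.map (algebraMap F (CoordRing F n))

/-- The action of `g` on the coordinate ring, which is induced by the base change
`(h_a) ↦ (g_{a'} h_a g_{a''}⁻¹)`: the variable `x_{rs}^a` is sent to the `(r, s)` entry of
`g_{a'}⁻¹ X_a g_{a''}`, where `a'` is the head and `a''` is the tail of `a`. -/
noncomputable def act (n : DimVector i) (g : ∀ v : V, GL (Fin (n.dim v)) F) :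
    CoordRing F n →ₐ[F] CoordRing F n :=
  MvPolynomial.aeval fun x =>
    (constMatrix n ((g x.1.right)⁻¹ : GL _ F).1 * genericMatrix F n x.1 *
      constMatrix n (g x.1.left).1) x.2.1 x.2.2

/-- The algebra of invariants of mixed representations of dimension `n`. -/
def invariants (n : DimVector i) : Subalgebra F (CoordRing F n) where
  carrier := {f | ∀ g ∈ GLn F n, act F n g f = f}
  mul_mem' := fun ha hb g hg => by rw [map_mul, ha g hg, hb g hg]
  add_mem' := fun ha hb g hg => by rw [map_add, ha g hg, hb g hg]
  algebraMap_mem' := fun r g _ => (act F n g).commutes r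

variable {F}

theorem constMatrix_mul (n : DimVector i) {k : ℕ} (M N : Matrix (Fin k) (Fin k) F) :
    constMatrix n (M * N) = constMatrix n M * constMatrix n N :=
  Matrix.map_mul

theorem constMatrix_one (n : DimVector i) {k : ℕ} :
    constMatrix n (1 : Matrix (Fin k) (Fin k) F) = 1 :=
  Matrix.map_one _ (map_zero _) (map_one _)

theorem act_genericMatrix (n : DimVector i) (g : ∀ v : V, GL (Fin (n.dim v)) F) (a : Arrow V) :
    (genericMatrix F n a).map (act F n g) =
      constMatrix n ((g a.right)⁻¹ : GL _ F).1 * genericMatrix F n a *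
        constMatrix n (g a.left).1 := by
  ext1 r s
  simp [genericMatrix, act]

theorem GLn_inv_eq {n : DimVector i} {g : ∀ v : V, GL (Fin (n.dim v)) F} (hg : g ∈ GLn F n)
    (v : V) : ((g v)⁻¹ : GL _ F).1 = (g (i v)).1ᵀ.submatrix
      (finCongr (n.dim_inv v).symm) (finCongr (n.dim_inv v).symm) := by
  rw [Units.inv_eq_of_mul_eq_one_right (hg v)]

theorem GLn_inv_eq' {n : DimVector i} {g : ∀ v : V, GL (Fin (n.dim v)) F} (hg : g ∈ GLn F n)
    (v : V) : ((g (i v))⁻¹ : GL _ F).1 = (g v).1ᵀ.submatrix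
      (finCongr (n.dim_inv v)) (finCongr (n.dim_inv v)) := by
  have h1 := hg v
  have h2 : (g (i v)).1 * (g v).1ᵀ.submatrix (finCongr (n.dim_inv v)) (finCongr (n.dim_inv v)) =
      ((g v).1 * (g (i v)).1ᵀ.submatrix (finCongr (n.dim_inv v).symm)
        (finCongr (n.dim_inv v).symm))ᵀ.submatrix (finCongr (n.dim_inv v))
          (finCongr (n.dim_inv v)) := by
    rw [Matrix.transpose_mul, ← Matrix.submatrix_mul_equiv _ _ _ (finCongr (n.dim_inv v))]
    rfl
  refine Units.inv_eq_of_mul_eq_one_right ?_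
  rw [h2, h1]
  simp

theorem act_letterMatrix {n : DimVector i} {g : ∀ v : V, GL (Fin (n.dim v)) F}
    (hg : g ∈ GLn F n) (a : DArrow V) :
    (letterMatrix F n a).map (act F n g) =
      constMatrix n ((g (DArrow.head i a))⁻¹ : GL _ F).1 * letterMatrix F n a *
        constMatrix n (g (DArrow.tail i a)).1 := by
  cases a with
  | inl a => exact act_genericMatrix n g a
  | inr a =>
    have h1 := act_genericMatrix n g a
    have h2 := congrArg (fun M => (Mᵀ).submatrix (finCongr (n.dim_inv a.left))
      (finCongr (n.dim_inv a.right))) h1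
    simp only [Matrix.transpose_mul] at h2
    rw [← Matrix.submatrix_mul_equiv _ _ _ (finCongr (n.dim_inv a.left)),
      ← Matrix.submatrix_mul_equiv _ _ _ (finCongr (n.dim_inv a.right)), ← Matrix.mul_assoc] at h2
    have h3 : constMatrix n ((g (i a.left))⁻¹ : GL _ F).1 =
        (constMatrix n (g a.left).1)ᵀ.submatrix (finCongr (n.dim_inv a.left))
          (finCongr (n.dim_inv a.left)) := by
      rw [GLn_inv_eq' hg]
      rfl
    have h4 : constMatrix n (g (i a.right)).1 =
        (constMatrix n ((g a.right)⁻¹ : GL _ F).1)ᵀ.submatrix (finCongr (n.dim_inv a.right))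
          (finCongr (n.dim_inv a.right)) := by
      rw [GLn_inv_eq hg]
      rfl
    rw [← h3, ← h4] at h2
    exact h2

theorem act_pathMatrix {n : DimVector i} {g : ∀ v : V, GL (Fin (n.dim v)) F}
    (hg : g ∈ GLn F n) (w : List (DArrow V)) (u v : V) (h : IsPath i u w v) :
    (pathMatrix F n u w v h).map (act F n g) =
      constMatrix n ((g u)⁻¹ : GL _ F).1 * pathMatrix F n u w v h *
        constMatrix n (g v).1 := by
  induction w generalizing u with
  | nil =>
    have h' : u = v := h
    subst h'
    have : pathMatrix F n u [] u h = 1 := by simp [pathMatrix]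
    rw [this, Matrix.mul_one, ← constMatrix_mul, Units.inv_mul, constMatrix_one]
    exact Matrix.map_one _ (map_zero _) (map_one _)
  | cons a w ih =>
    obtain ⟨h1, h2⟩ := h
    subst h1
    have : pathMatrix F n _ (a :: w) v ⟨rfl, h2⟩ =
        letterMatrix F n a * pathMatrix F n _ w v h2 := rfl
    have hc : constMatrix n (g (DArrow.tail i a)).1 *
        constMatrix n ((g (DArrow.tail i a))⁻¹ : GL _ F).1 =
          (1 : Matrix _ _ (CoordRing F n)) := by
      rw [← constMatrix_mul, Units.mul_inv, constMatrix_one]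
    rw [this, Matrix.map_mul, act_letterMatrix hg, ih]
    simp only [Matrix.mul_assoc]
    rw [← Matrix.mul_assoc _ (constMatrix n ((g (DArrow.tail i a))⁻¹ : GL _ F).1), hc, Matrix.one_mul]

theorem pathMatrix_append (n : DimVector i) {w z : List (DArrow V)} {u x v : V}
    (h : IsPath i u w x) (h' : IsPath i x z v) (h'' : IsPath i u (w ++ z) v) :
    pathMatrix F n u (w ++ z) v h'' = pathMatrix F n u w x h * pathMatrix F n x z v h' := by
  induction w generalizing u with
  | nil =>
    have h1 : u = x := h
    subst h1
    simp [pathMatrix]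
  | cons a w ih =>
    simp only [List.cons_append, pathMatrix, Matrix.mul_assoc]
    rw [ih h.2]

theorem letterMatrix_swap (n : DimVector i) (a : DArrow V)
    (e : n.dim (DArrow.head i (Sum.swap a)) = n.dim (DArrow.tail i a))
    (e' : n.dim (DArrow.tail i (Sum.swap a)) = n.dim (DArrow.head i a)) :
    letterMatrix F n (Sum.swap a) =
      (letterMatrix F n a)ᵀ.submatrix (finCongr e) (finCongr e') := by
  cases a with
  | inl a => rfl
  | inr a =>
    rfl

theorem pathMatrix_wordTranspose (hi : Function.Involutive i) (n : DimVector i)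
    {w : List (DArrow V)} {u v : V} (h : IsPath i u w v)
    (h' : IsPath i (i v) (wordTranspose w) (i u)) :
    pathMatrix F n (i v) (wordTranspose w) (i u) h' =
      (pathMatrix F n u w v h)ᵀ.submatrix (finCongr (n.dim_inv v)) (finCongr (n.dim_inv u)) := by
  induction w generalizing u with
  | nil =>
    have h1 : u = v := h
    subst h1
    ext r s
    simp [pathMatrix, wordTranspose, Matrix.one_apply, Fin.ext_iff]
  | cons a w ih =>
    obtain ⟨h1, h2⟩ := h
    subst h1
    have h3 := isPath_wordTranspose hi h2
    have hs : IsPath i (i (DArrow.tail i a)) [Sum.swap a] (i (DArrow.head i a)) := by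
      cases a <;> simp [IsPath, DArrow.head, DArrow.tail, hi _]
    have hw : wordTranspose (a :: w) = wordTranspose w ++ [Sum.swap a] := by
      simp [wordTranspose]
    have hM : pathMatrix F n _ [Sum.swap a] _ hs = (letterMatrix F n a)ᵀ.submatrix
        (finCongr (n.dim_inv _)) (finCongr (n.dim_inv _)) := by
      have e : n.dim (DArrow.head i (Sum.swap a)) = n.dim (DArrow.tail i a) := by
        rw [hs.1, n.dim_inv]
      have e' : n.dim (DArrow.tail i (Sum.swap a)) = n.dim (DArrow.head i a) := by
        rw [show DArrow.tail i (Sum.swap a) = _ from hs.2, n.dim_inv]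
      simp only [pathMatrix]
      rw [letterMatrix_swap n a e e']
      exact mul_one_submatrix _ _
    have key : ∀ (z : List (DArrow V)) (hz : z = wordTranspose w ++ [Sum.swap a])
        (hp : IsPath i (i v) z (i (DArrow.head i a))),
        pathMatrix F n _ z _ hp = pathMatrix F n _ _ _ h3 * pathMatrix F n _ _ _ hs := by
      intro z hz hp
      subst hz
      exact pathMatrix_append n h3 hs hp
    rw [key _ hw, ih h2 h3, hM, Matrix.submatrix_mul_equiv, ← Matrix.transpose_mul]
    simp [pathMatrix]

/-- The matrix `X_a` of a closed path `a` in the double quiver. -/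
noncomputable def ClosedPath.matrix (n : DimVector i) (a : ClosedPath i) :
    Matrix (Fin (n.dim a.vertex)) (Fin (n.dim a.vertex)) (CoordRing F n) :=
  pathMatrix F n a.vertex a.word a.vertex a.isPath

/-- The image of `σ_t(a)`: it is `σ_t(X_a)` for `t ≤ n (head a)` and zero otherwise. -/
noncomputable def sigmaValue (F : Type*) [Field F] (n : DimVector i) (t : ℕ)
    (a : ClosedPath i) : CoordRing F n :=
  if t ≤ n.dim a.vertex then sigma t (a.matrix (F := F) n) else 0

theorem sigmaValue_eq (n : DimVector i) (t : ℕ) (a : ClosedPath i) :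
    sigmaValue F n t a = (Matrix.det (1 + (Polynomial.X : (CoordRing F n)[X]) •
      (a.matrix (F := F) n).map Polynomial.C)).coeff t :=
  sigma_ite t _

theorem sigmaValue_mem (n : DimVector i) (t : ℕ) (a : ClosedPath i) :
    sigmaValue F n t a ∈ invariants F n := by
  intro g hg
  rw [sigmaValue_eq]
  set φ : (CoordRing F n) →+* (CoordRing F n) := (act F n g : CoordRing F n →+* CoordRing F n)
  have h0 : ∀ P : (CoordRing F n)[X], act F n g (P.coeff t) = (P.map φ).coeff t := by
    intro P
    rw [Polynomial.coeff_map]; rfl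
  rw [h0]
  congr 1
  have h1 : (Polynomial.mapRingHom φ).mapMatrix
      (1 + (Polynomial.X : (CoordRing F n)[X]) • (a.matrix (F := F) n).map Polynomial.C) =
      1 + (Polynomial.X : (CoordRing F n)[X]) •
        ((a.matrix (F := F) n).map (act F n g)).map Polynomial.C := by
    rw [map_add, map_one]
    congr 1
    ext1 r s
    simp [φ]
  have h2 : Polynomial.map φ (Matrix.det
      (1 + (Polynomial.X : (CoordRing F n)[X]) • (a.matrix (F := F) n).map Polynomial.C)) =
      Matrix.det ((Polynomial.mapRingHom φ).mapMatrix
        (1 + (Polynomial.X : (CoordRing F n)[X]) • (a.matrix (F := F) n).map Polynomial.C)) := by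
    rw [← RingHom.map_det]; rfl
  rw [h2, h1, ClosedPath.matrix, act_pathMatrix hg, Matrix.map_mul, ← Matrix.smul_mul,
    Matrix.det_one_add_mul_comm, Matrix.mul_smul, ← Matrix.map_mul, ← Matrix.mul_assoc,
    ← constMatrix_mul, Units.mul_inv, constMatrix_one, Matrix.one_mul]

theorem sigmaValue_rotated (n : DimVector i) (t : ℕ) {a b : ClosedPath i}
    (h : a.word ~r b.word) : sigmaValue F n t a = sigmaValue F n t b := by
  obtain ⟨k, hk⟩ := h
  rw [List.rotate_eq_drop_append_take_mod] at hk
  have hw := List.take_append_drop (k % a.word.length) a.word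
  generalize List.take (k % a.word.length) a.word = y at hk hw
  generalize List.drop (k % a.word.length) a.word = z at hk hw
  obtain ⟨w, u, hne, hp⟩ := a
  obtain ⟨w', u', hne', hp'⟩ := b
  simp only at hk hw
  subst hk hw
  obtain ⟨x, h1, h2⟩ := isPath_append.1 hp
  have hx : IsPath i x (z ++ y) x := isPath_append.2 ⟨u, h2, h1⟩
  obtain ⟨hxu, -⟩ := isPath_unique hne' hx hp'
  subst hxu
  rw [sigmaValue_eq, sigmaValue_eq, ClosedPath.matrix, ClosedPath.matrix,
    pathMatrix_append n h1 h2, pathMatrix_append n h2 h1, Matrix.map_mul, Matrix.map_mul,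
    ← Matrix.smul_mul, Matrix.det_one_add_mul_comm, Matrix.mul_smul]

/-- The transpose of a closed path. -/
def ClosedPath.transpose (hi : Function.Involutive i) (a : ClosedPath i) : ClosedPath i where
  word := wordTranspose a.word
  vertex := i a.vertex
  ne_nil := by simpa [wordTranspose] using a.ne_nil
  isPath := isPath_wordTranspose hi a.isPath

theorem sigmaValue_transpose (hi : Function.Involutive i) (n : DimVector i) (t : ℕ)
    (a : ClosedPath i) : sigmaValue F n t (a.transpose hi) = sigmaValue F n t a := by
  have h1 : (a.transpose hi).matrix (F := F) n = (a.matrix n)ᵀ.submatrix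
      (finCongr (n.dim_inv a.vertex)) (finCongr (n.dim_inv a.vertex)) :=
    pathMatrix_wordTranspose hi n a.isPath (isPath_wordTranspose hi a.isPath)
  rw [sigmaValue_eq, sigmaValue_eq, h1]
  exact congrArg (fun P : (CoordRing F n)[X] => P.coeff t) (det_transpose_submatrix _ _)

theorem sigmaValue_congr (hi : Function.Involutive i) (n : DimVector i) (t : ℕ)
    {a b : ClosedPath i} (h : a.Equivalent b) : sigmaValue F n t a = sigmaValue F n t b := by
  rcases h with h | h
  · exact sigmaValue_rotated n t h
  · rw [← sigmaValue_transpose hi n t b]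
    exact sigmaValue_rotated n t h

/-- The homomorphism from the polynomial ring in the symbols `σ_t(a)` to the algebra of
invariants, which sends `σ_t(a)` to `σ_t(X_a)` if `t ≤ n (head a)` and to zero otherwise. -/
noncomputable def Upsilon (F : Type*) [Field F] (hi : Function.Involutive i) (n : DimVector i) :
    NSigma F i →ₐ[F] invariants F n :=
  MvPolynomial.aeval fun x =>
    Quotient.lift (s := primSetoid i)
      (fun a : PrimPath i => (⟨sigmaValue F n x.1 a.1, sigmaValue_mem n x.1 a.1⟩ : invariants F n))
      (fun _ _ h => Subtype.ext (sigmaValue_congr hi n x.1 h)) x.2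

/-- The ideal of relations between the invariants of mixed representations of dimension `n`. -/
noncomputable def relations (F : Type*) [Field F] (hi : Function.Involutive i)
    (n : DimVector i) : Ideal (NSigma F i) :=
  RingHom.ker (Upsilon F hi n)

/-- The ideal of free relations: those valid for every positive dimension vector. -/
noncomputable def freeRelations (F : Type*) [Field F] (hi : Function.Involutive i) :
    Ideal (NSigma F i) :=
  ⨅ (m : DimVector i) (_ : ∀ v, 0 < m.dim v), relations F hi m

end Invariants

end MixedQuiver

/-! A free relation `f` must vanish once the values of the `σ_t(X_a)` can be prescribed
independently. Over the fraction field of the ring of symbols, choose matrices of one common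
positive size at which `σ_t(X_a)` equals the symbol `σ_t(a)`, for every symbol occurring in `f`.
Evaluating the image of `f` there returns `f` itself, so `f = 0`.

The polynomials `det (1 + λ X_a)` multiply under direct sums, so it suffices to give one class, that
of a primitive closed path `c`, an arbitrary polynomial `h` with `h(0) = 1`, and all other classes
the polynomial 1. Take the oriented cycle spelled by `c`, one edge having as weight a matrix `M`
with `det (1 + λ M) = h`, the others weight 1. Let `F_w` be the product along `w`. Then `F_c` is `M`
placed in one diagonal block, while `F_w` is nilpotent for primitive `w` not a rotation of `c`
(`isNilpotent_prod_cycleMatrix`).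

To respect transposition put `X_x = F_x + (F_{xᵀ})ᵀ`. Since `i` fixes no vertex, no letter of a path
is followed by its transpose. Hence the mixed products vanish and `det (1 + λ X_w) = det (1 + λ F_w)
det (1 + λ F_{wᵀ})` (`revDet_prod_dualizedMatrix`). For the same reason `c` is not a rotation of
`cᵀ`, so the factor `h` appears exactly once (`isRealizable_mulSingle`). -/

namespace MixedQuiver

/-! ### Primitive words and powers. -/

section Combinatorics

variable {α : Type*}

/-- The power `w ^ k` of a word. -/
abbrev wordPow (w : List α) (k : ℕ) : List α := (List.replicate k w).flatten

theorem wordPow_succ (w : List α) (k : ℕ) : wordPow w (k + 1) = w ++ wordPow w k := by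
  simp [wordPow, List.replicate_succ]

theorem wordPow_add (w : List α) (k l : ℕ) : wordPow w (k + l) = wordPow w k ++ wordPow w l := by
  rw [wordPow, List.replicate_add, List.flatten_append]

theorem wordPow_succ' (w : List α) (k : ℕ) : wordPow w (k + 1) = wordPow w k ++ w := by
  rw [wordPow_add]; simp [wordPow]

theorem length_wordPow (w : List α) (k : ℕ) : (wordPow w k).length = k * w.length := by
  simp [wordPow]

theorem wordPow_prefix {w : List α} {k l : ℕ} (h : k ≤ l) : wordPow w k <+: wordPow w l := by
  obtain ⟨m, rfl⟩ := Nat.exists_eq_add_of_le h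
  rw [wordPow_add]; exact List.prefix_append _ _

theorem wordPow_mul (w : List α) (k l : ℕ) : wordPow w (k * l) = wordPow (wordPow w k) l := by
  induction l with
  | zero => simp [wordPow]
  | succ l ih => rw [Nat.mul_succ, wordPow_add, wordPow_succ', ih]

/-- Commuting words are powers of a common word. -/
theorem exists_wordPow_of_append_comm (u v : List α) (h : u ++ v = v ++ u) :
    ∃ z k l, u = wordPow z k ∧ v = wordPow z l := by
  induction hn : u.length + v.length using Nat.strong_induction_on generalizing u v with
  | _ n ih =>
    wlog hle : u.length ≤ v.length generalizing u v
    · obtain ⟨z, k, l, h1, h2⟩ := this v u h.symm (by omega) (by omega)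
      exact ⟨z, l, k, h2, h1⟩
    by_cases hu : u = []
    · exact ⟨v, 0, 1, by simp [hu, wordPow], by simp [wordPow]⟩
    -- Euclid's algorithm on the lengths: the shorter word is a prefix of the longer one, and
    -- cancelling it leaves a commuting pair.
    have hp : u <+: v := List.prefix_of_prefix_length_le
      (h ▸ List.prefix_append u v : u <+: v ++ u) (List.prefix_append v u) hle
    obtain ⟨v', rfl⟩ := hp
    have h' : u ++ v' = v' ++ u := by
      rw [List.append_assoc] at h
      exact List.append_cancel_left h
    have : 0 < u.length := List.length_pos_iff.2 hu
    obtain ⟨z, k, l, h1, h2⟩ := ih (u.length + v'.length) (by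
      simp only [List.length_append] at hn; omega) u v' h' rfl
    exact ⟨z, k, k + l, h1, by rw [wordPow_add, ← h1, ← h2]⟩

/-- A nonempty word which is not a product of two nonempty commuting words. -/
def IsPrimitiveWord (w : List α) : Prop :=
  w ≠ [] ∧ ∀ u v, w = u ++ v → w = v ++ u → u = [] ∨ v = []

theorem IsPrimitiveWord.eq_of_eq_wordPow {w z : List α} (hw : IsPrimitiveWord w) {k : ℕ}
    (h : w = wordPow z k) : w = z := by
  match k, h with
  | 0, h => exact absurd (by simpa [wordPow] using h) hw.1
  | k + 1, h =>
    rcases hw.2 z (wordPow z k) (h.trans (wordPow_succ z k)) (h.trans (wordPow_succ' z k)) with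
      h1 | h1
    · subst h1
      exact h.trans (by simp [wordPow])
    · rw [h, wordPow_succ, h1, List.append_nil]

theorem append_comm_of_wordPow_eq {w d : List α} {r m : ℕ} (hr : 0 < r) (hm : 0 < m)
    (h : wordPow w r = wordPow d m) : w ++ d = d ++ w := by
  have key : ∀ {w d : List α} {r m : ℕ}, 0 < m → wordPow w r = wordPow d m →
      w ++ d <+: wordPow w (3 * r + 1) := by
    intro w d r m hm h
    rw [wordPow_succ, List.prefix_append_right_inj]
    have h1 : d <+: wordPow w r := by
      rw [h]; simpa [wordPow] using wordPow_prefix (w := d) hm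
    exact h1.trans (wordPow_prefix (by omega))
  have h3 : wordPow w (3 * r) = wordPow d (3 * m) := by
    rw [mul_comm, mul_comm 3, wordPow_mul, wordPow_mul, h]
  -- Both `w ++ d` and `d ++ w` are prefixes, of equal length, of the common word `w ^ (6r) = d ^
  -- (6m)`; the factor 6 is merely large enough.
  have h1 : w ++ d <+: wordPow w (3 * r + 3 * r) :=
    (key hm h).trans (wordPow_prefix (by omega))
  have h2 : d ++ w <+: wordPow d (3 * m + 3 * m) :=
    (key hr h.symm).trans (wordPow_prefix (by omega))
  rw [wordPow_add, h3, ← wordPow_add] at h1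
  exact (List.prefix_of_prefix_length_le h1 h2 (by simp [add_comm])).eq_of_length
    (by simp [add_comm])

theorem IsPrimitiveWord.eq_of_wordPow_eq {w d : List α} (hw : IsPrimitiveWord w)
    (hd : IsPrimitiveWord d) {r m : ℕ} (hr : 0 < r) (hm : 0 < m)
    (h : wordPow w r = wordPow d m) : w = d := by
  obtain ⟨z, k, l, h1, h2⟩ :=
    exists_wordPow_of_append_comm w d (append_comm_of_wordPow_eq hr hm h)
  rw [hw.eq_of_eq_wordPow h1, hd.eq_of_eq_wordPow h2]

/-- If `d = u ++ v = v ++ u`, then `d` is fixed by rotation through `u.length`. Rotations commute,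
so `w` is fixed too and splits at that place into commuting factors. -/
theorem IsPrimitiveWord.of_isRotated {w d : List α} (hw : IsPrimitiveWord w) (h : d ~r w) :
    IsPrimitiveWord d := by
  refine ⟨fun h0 => hw.1 (by simpa [h0] using h), fun u v h1 h2 => ?_⟩
  obtain ⟨n, rfl⟩ := h
  by_contra! hne
  have hlen : d.length = u.length + v.length := by rw [h1, List.length_append]
  have hu : 0 < u.length := List.length_pos_iff.2 hne.1
  have hv : 0 < v.length := List.length_pos_iff.2 hne.2
  have hd : d.rotate u.length = d := by
    conv_lhs => rw [h1]
    rw [List.rotate_append_length_eq, ← h2]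
  have hr : (d.rotate n).rotate u.length = d.rotate n := by
    rw [List.rotate_rotate, add_comm, ← List.rotate_rotate, hd]
  have hle : u.length ≤ (d.rotate n).length := by rw [List.length_rotate]; omega
  rcases hw.2 _ _ (List.take_append_drop u.length (d.rotate n)).symm
    (by rw [← List.rotate_eq_drop_append_take hle, hr]) with h | h
  · have := congrArg List.length h
    simp only [List.length_take, List.length_rotate, List.length_nil] at this
    omega
  · have := congrArg List.length h
    simp only [List.length_drop, List.length_rotate, List.length_nil] at this
    omega

end Combinatorics

/-! ### Reduced words, transposition and primitive closed paths. -/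

section Paths

variable {V : Type*} [Quiver V] {i : V → V}

theorem wordTranspose_append (w z : List (DArrow V)) :
    wordTranspose (w ++ z) = wordTranspose z ++ wordTranspose w := by
  simp [wordTranspose]

theorem wordTranspose_eq_nil {w : List (DArrow V)} : wordTranspose w = [] ↔ w = [] := by
  simp [wordTranspose]

theorem length_wordTranspose (w : List (DArrow V)) : (wordTranspose w).length = w.length := by
  simp [wordTranspose]

theorem IsPrimitiveWord.wordTranspose {w : List (DArrow V)} (hw : IsPrimitiveWord w) :
    IsPrimitiveWord (wordTranspose w) := by
  refine ⟨fun h => hw.1 (wordTranspose_eq_nil.1 h), fun u v h1 h2 => ?_⟩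
  have h1' := congrArg MixedQuiver.wordTranspose h1
  have h2' := congrArg MixedQuiver.wordTranspose h2
  rw [wordTranspose_wordTranspose, wordTranspose_append] at h1' h2'
  rcases hw.2 _ _ h1' h2' with h | h
  · exact Or.inr (wordTranspose_eq_nil.1 h)
  · exact Or.inl (wordTranspose_eq_nil.1 h)

/-- No letter of the word is followed by its transpose. -/
abbrev IsReducedWord (w : List (DArrow V)) : Prop := w.IsChain fun x y => y ≠ x.swap

/-- The tail of `x` and the head of its transpose are interchanged by `i`, so joining them would
give a fixed vertex. This is where the absence of fixed vertices enters. -/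
theorem IsPath.isReducedWord (hfix : ∀ v, i v ≠ v) {w : List (DArrow V)} {u v : V}
    (h : IsPath i u w v) : IsReducedWord w := by
  induction w generalizing u with
  | nil => exact List.isChain_nil
  | cons x w ih =>
    cases w with
    | nil => exact List.isChain_singleton _
    | cons y w =>
      refine List.isChain_cons_cons.2 ⟨?_, ih h.2⟩
      rintro rfl
      have h1 : DArrow.head i x.swap = DArrow.tail i x := h.2.1
      cases x with
      | inl a => exact hfix _ h1
      | inr a => exact hfix _ h1.symm

/-- Peeling off outer letters leads to a middle that is either one letter equal to its own
transpose, which is impossible, or a letter followed by its transpose, which is excluded. -/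
theorem IsReducedWord.eq_nil_of_wordTranspose_eq {w : List (DArrow V)} (h : IsReducedWord w)
    (hw : wordTranspose w = w) : w = [] := by
  induction w using List.bidirectionalRec with
  | nil => rfl
  | singleton x => cases x <;> simp [wordTranspose] at hw
  | cons_append x l y ih =>
    exfalso
    have h1 : wordTranspose (x :: (l ++ [y])) = y.swap :: (wordTranspose l ++ [x.swap]) := by
      simp [wordTranspose]
    rw [h1, List.cons.injEq] at hw
    obtain ⟨-, h2⟩ := hw
    obtain ⟨h3, h4⟩ := List.append_inj' h2 rfl
    have h5 : IsReducedWord (l ++ [y]) := h.tail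
    have h6 := ih (List.isChain_append.1 h5).1 h3
    subst h6
    exact (List.isChain_cons_cons.1 h).1 (by simpa using h4.symm)

/-- If `w = yz` and `zy = wᵀ = zᵀyᵀ`, comparing lengths shows that `y` and `z` are each their own
transpose, hence empty. -/
theorem IsReducedWord.not_isRotated_wordTranspose {w : List (DArrow V)} (h : IsReducedWord w)
    (hne : w ≠ []) : ¬ w ~r wordTranspose w := by
  rintro ⟨n, hn⟩
  rw [List.rotate_eq_drop_append_take_mod] at hn
  have hw := List.take_append_drop (n % w.length) w
  generalize List.take (n % w.length) w = y at hn hw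
  generalize List.drop (n % w.length) w = z at hn hw
  subst hw
  rw [wordTranspose_append] at hn
  obtain ⟨h1, h2⟩ := List.append_inj hn (length_wordTranspose z).symm
  obtain ⟨h3, h4, -⟩ := List.isChain_append.1 h
  exact hne (by rw [IsReducedWord.eq_nil_of_wordTranspose_eq h3 h2.symm,
    IsReducedWord.eq_nil_of_wordTranspose_eq h4 h1.symm]; rfl)

theorem ClosedPath.IsPrimitive.isPrimitiveWord {a : ClosedPath i} (ha : a.IsPrimitive) :
    IsPrimitiveWord a.word := by
  refine ⟨a.ne_nil, fun u v h1 h2 => ?_⟩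
  by_contra! hne
  obtain ⟨z, k, l, hk, hl⟩ := exists_wordPow_of_append_comm u v (h1.symm.trans h2)
  have hw : a.word = wordPow z (k + l) := by rw [h1, wordPow_add, ← hk, ← hl]
  have hz : z ≠ [] := by
    rintro rfl
    exact hne.1 (by simpa [wordPow] using hk)
  have hk0 : k ≠ 0 := by
    rintro rfl
    exact hne.1 (by simpa [wordPow] using hk)
  have hl0 : l ≠ 0 := by
    rintro rfl
    exact hne.2 (by simpa [wordPow] using hl)
  obtain ⟨n, hn⟩ : ∃ n, k + l = n + 2 := ⟨k + l - 2, by omega⟩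
  rw [hn] at hw
  -- The first copy of `z` starts at the vertex of `a` and the last one ends there. A nonempty path
  -- determines its ends, so `z` is itself closed.
  have hp := a.isPath
  have hp' := a.isPath
  rw [hw, wordPow_succ, isPath_append] at hp
  rw [hw, wordPow_succ', isPath_append] at hp'
  obtain ⟨x, hx, -⟩ := hp
  obtain ⟨y, -, hy⟩ := hp'
  obtain ⟨-, rfl⟩ := isPath_unique hz hx hy
  refine ha ⟨⟨z, a.vertex, hz, hx⟩, n + 2, ?_, hw⟩
  have : 0 < z.length := List.length_pos_iff.2 hz
  simp only [hw, length_wordPow]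
  nlinarith

end Paths

/-! ### The polynomial `det (1 + λ M)`. -/

section ReversePolynomial

variable {S : Type*} [CommRing S] {m n : Type*} [Fintype m] [DecidableEq m] [Fintype n]
  [DecidableEq n]

/-- The polynomial `det (1 + λ M)`. -/
noncomputable def revDet (M : Matrix n n S) : S[X] :=
  Matrix.det (1 + (Polynomial.X : S[X]) • M.map Polynomial.C)

theorem revDet_eq_charpolyRev (M : Matrix n n S) : revDet M = (-M).charpolyRev := by
  rw [revDet, Matrix.charpolyRev]
  congr 1
  ext a b
  simp

theorem revDet_zero : revDet (0 : Matrix n n S) = 1 := by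
  rw [revDet, Matrix.map_zero _ (map_zero _), smul_zero, add_zero, det_one]

theorem revDet_of_isEmpty [IsEmpty n] (M : Matrix n n S) : revDet M = 1 := det_isEmpty

theorem revDet_transpose (M : Matrix n n S) : revDet Mᵀ = revDet M := by
  rw [revDet, ← det_transpose, revDet]
  congr 1
  simp [transpose_map]

theorem revDet_submatrix (e : m ≃ n) (M : Matrix n n S) :
    revDet (M.submatrix e e) = revDet M := by
  rw [revDet, revDet, ← det_submatrix_equiv_self e]
  congr 1
  ext a b
  simp [Matrix.one_apply]

/-- The product `(1 + λM)(1 + λN)` differs from `1 + λ(M + N)` only by `λ²MN`. -/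
theorem revDet_add_of_mul_eq_zero {M N : Matrix n n S} (h : M * N = 0) :
    revDet (M + N) = revDet M * revDet N := by
  have h1 : M.map Polynomial.C * N.map Polynomial.C = 0 := by
    rw [← Matrix.map_mul, h, Matrix.map_zero _ (map_zero _)]
  rw [revDet, revDet, revDet, ← det_mul, Matrix.map_add _ (map_add _)]
  congr 1
  simp [add_mul, mul_add, h1, add_assoc, add_comm]

theorem revDet_fromBlocks (M : Matrix m m S) (N : Matrix n n S) :
    revDet (fromBlocks M 0 0 N) = revDet M * revDet N := by
  rw [revDet, revDet, revDet, fromBlocks_map, fromBlocks_smul, ← fromBlocks_one, fromBlocks_add,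
    Matrix.map_zero _ (map_zero _), Matrix.map_zero _ (map_zero _), smul_zero, smul_zero, add_zero,
    add_zero, det_fromBlocks_zero₂₁]

theorem revDet_mul_comm (M : Matrix m n S) (N : Matrix n m S) :
    revDet (M * N) = revDet (N * M) := by
  rw [revDet, revDet, Matrix.map_mul, Matrix.map_mul, ← Matrix.smul_mul,
    Matrix.det_one_add_mul_comm, Matrix.mul_smul]

theorem map_revDet {S' : Type*} [CommRing S'] (φ : S →+* S') (M : Matrix n n S) :
    (revDet M).map φ = revDet (M.map φ) := by
  rw [revDet, ← Polynomial.coe_mapRingHom, RingHom.map_det, revDet]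
  congr 1
  ext1 a b
  simp [Matrix.one_apply, apply_ite (Polynomial.map φ)]

/-- Nilpotency makes the polynomial a unit; over a domain it is then constant, equal to its value 1
at 0. -/
theorem revDet_of_isNilpotent [IsDomain S] {M : Matrix n n S} (hM : IsNilpotent M) :
    revDet M = 1 := by
  rw [revDet_eq_charpolyRev]
  obtain ⟨c, -, hc⟩ := Polynomial.isUnit_iff.1 (isUnit_charpolyRev_of_isNilpotent hM.neg)
  have h : (-M).charpolyRev.eval 0 = 1 := Matrix.eval_charpolyRev
  rw [← hc, eval_C] at h
  rw [← hc, h, map_one]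

/-- The determinant of `1 + λ M`, where the blocks of `M` vanish except for one diagonal block. -/
theorem revDet_comp_single (a : m) (M : Matrix n n S) :
    revDet (comp m m n n S (Matrix.single a a M)) = revDet M := by
  -- `P` embeds the block `a`: the big matrix is `P M Pᵀ` with `Pᵀ P = 1`, and cyclicity applies.
  let P : Matrix (m × n) n S := Matrix.of fun x y => if a = x.1 then (1 : Matrix n n S) x.2 y else 0
  have h1 : comp m m n n S (Matrix.single a a M) = P * (M * Pᵀ) := by
    ext ⟨x, x'⟩ ⟨y, y'⟩
    obtain rfl | hx := eq_or_ne a x <;> obtain rfl | hy := eq_or_ne a y <;>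
      simp [P, Matrix.mul_apply, Matrix.one_apply, *]
  have h2 : Pᵀ * P = 1 := by
    ext x y
    simp [P, Matrix.mul_apply, Fintype.sum_prod_type, Matrix.one_apply, eq_comm]
  rw [h1, revDet_mul_comm, Matrix.mul_assoc, h2, Matrix.mul_one]

/-- The reverse of `h` is monic, hence the characteristic polynomial of multiplication by the root
in the ring it defines. Since `h(0) ≠ 0`, reversing twice gives `h` back. -/
theorem exists_revDet_eq {K : Type*} [Field K] (h : K[X]) (h0 : h.coeff 0 = 1) :
    ∃ (k : ℕ) (M : Matrix (Fin k) (Fin k) K), revDet M = h := by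
  have hm : h.reverse.Monic := by
    rw [Monic, reverse_leadingCoeff, trailingCoeff, natTrailingDegree_eq_zero.2 (Or.inr (by simp [h0])), h0]
  have hr : h.reverse.reverse = h := by
    ext t
    rw [coeff_reverse, reverse_natDegree, natTrailingDegree_eq_zero.2 (Or.inr (by simp [h0])),
      coeff_reverse]
    simp
  let pb := AdjoinRoot.powerBasis hm.ne_zero
  refine ⟨pb.dim, -Algebra.leftMulMatrix pb.basis pb.gen, ?_⟩
  rw [revDet_eq_charpolyRev, neg_neg, ← reverse_charpoly, charpoly_leftMulMatrix,
    AdjoinRoot.minpoly_powerBasis_gen_of_monic hm, hr]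

end ReversePolynomial

/-! ### The weighted cycle of a primitive word and its dualization. -/

section CycleRepresentation

variable {V : Type*} [Quiver V] {i : V → V} {S : Type*} [CommRing S] {k : ℕ}

/-- The cyclic permutations of a word. -/
abbrev Rotations (c : List (DArrow V)) := {d : List (DArrow V) // d ∈ c.cyclicPermutations}

noncomputable instance (c : List (DArrow V)) : Fintype (Rotations c) :=
  @Fintype.ofFinite _ (List.finite_toSet c.cyclicPermutations)

noncomputable instance (c : List (DArrow V)) : DecidableEq (Rotations c) := Classical.decEq _

theorem Rotations.isRotated {c : List (DArrow V)} (d : Rotations c) : d.1 ~r c :=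
  List.mem_cyclicPermutations_iff.1 d.2

/-- The first cyclic permutation of a cyclic permutation. -/
def Rotations.next {c : List (DArrow V)} (d : Rotations c) : Rotations c :=
  ⟨d.1.rotate 1, List.mem_cyclicPermutations_iff.2 ((List.IsRotated.forall _ _).trans d.isRotated)⟩

/-- The word `c` as a cyclic permutation of itself. -/
def Rotations.base (c : List (DArrow V)) : Rotations c :=
  ⟨c, List.mem_cyclicPermutations_self c⟩

theorem Rotations.next_injective {c : List (DArrow V)} :
    Function.Injective (Rotations.next (c := c)) := fun _ _ h =>
  Subtype.ext (List.rotate_injective 1 (congrArg Subtype.val h))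

open Classical in
/-- The matrix, with entries in a matrix ring, by which a letter acts on the cycle whose vertices
are the cyclic permutations of `c`: a cyclic permutation starting with the letter `x` is joined by
`x` with the next one, and all weights are one except for that of the edge starting in `c`. -/
noncomputable def cycleMatrix (c : List (DArrow V)) (M : Matrix (Fin k) (Fin k) S)
    (x : DArrow V) : Matrix (Rotations c) (Rotations c) (Matrix (Fin k) (Fin k) S) :=
  Matrix.of fun d d' => if d.1.head? = some x ∧ d' = d.next then
    (if d = Rotations.base c then M else 1) else 0

variable (c : List (DArrow V)) (M : Matrix (Fin k) (Fin k) S)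

theorem cycleMatrix_ne_zero {c : List (DArrow V)} {M : Matrix (Fin k) (Fin k) S} {x : DArrow V} {d d' : Rotations c}
    (h : cycleMatrix c M x d d' ≠ 0) : d.1.head? = some x ∧ d' = d.next := by
  by_contra hn
  exact h (by rw [cycleMatrix, of_apply, if_neg hn])

theorem cycleMatrix_mul_apply (x : DArrow V)
    (N : Matrix (Rotations c) (Rotations c) (Matrix (Fin k) (Fin k) S)) {d : Rotations c}
    (h : d.1.head? = some x) (d' : Rotations c) [Decidable (d = Rotations.base c)] :
    (cycleMatrix c M x * N) d d' = (if d = Rotations.base c then M else 1) * N d.next d' := by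
  rw [Matrix.mul_apply, Finset.sum_eq_single d.next]
  · simp only [cycleMatrix, of_apply, h, true_and, if_true]
    congr
  · intro b _ hb
    rw [cycleMatrix, of_apply, if_neg (fun h' => hb h'.2), zero_mul]
  · simp

theorem exists_of_mul_apply_ne_zero {R n : Type*} [Semiring R] [Fintype n] {A B : Matrix n n R}
    {a b : n} (h : (A * B) a b ≠ 0) : ∃ z, A a z ≠ 0 ∧ B z b ≠ 0 := by
  rw [Matrix.mul_apply] at h
  obtain ⟨z, -, hz⟩ := Finset.exists_ne_zero_of_sum_ne_zero h
  exact ⟨z, left_ne_zero_of_mul hz, right_ne_zero_of_mul hz⟩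

/-- Each rotation has a single outgoing edge, labelled by its first letter. A walk from `d`
therefore reads the periodic word `ddd…` and rotates once per letter. -/
theorem prefix_of_prod_cycleMatrix_ne_zero {c : List (DArrow V)} {M : Matrix (Fin k) (Fin k) S} {w : List (DArrow V)} {d d' : Rotations c}
    (h : (w.map (cycleMatrix c M)).prod d d' ≠ 0) :
    w <+: wordPow d.1 w.length ∧ d'.1 = d.1.rotate w.length := by
  induction w generalizing d with
  | nil =>
    refine ⟨List.nil_prefix, ?_⟩
    by_contra hn
    refine h (Matrix.one_apply_ne fun h' => hn ?_)
    simp [h']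
  | cons x w ih =>
    rw [List.map_cons, List.prod_cons] at h
    obtain ⟨e, he, he'⟩ := exists_of_mul_apply_ne_zero h
    obtain ⟨h1, rfl⟩ := cycleMatrix_ne_zero he
    obtain ⟨h2, h3⟩ := ih he'
    obtain ⟨v, hv⟩ := List.head?_eq_some_iff.1 h1
    have hn : d.next.1 = v ++ [x] := by simp [Rotations.next, hv]
    rw [hn] at h2
    refine ⟨?_, ?_⟩
    · have h4 : ∀ n, x :: wordPow (v ++ [x]) n = wordPow (x :: v) n ++ [x] := by
        intro n
        induction n with
        | zero => simp [wordPow]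
        | succ n ihn =>
          rw [wordPow_succ', ← List.cons_append, ihn, wordPow_succ']
          simp
      rw [hv, List.length_cons]
      refine List.IsPrefix.trans ((List.prefix_cons_inj x).2 h2) ?_
      rw [h4, wordPow_succ']
      simp
    · rw [h3, List.length_cons, Rotations.next, List.rotate_rotate, add_comm]

theorem prod_map_wordPow {R α : Type*} [Monoid R] (f : α → R) (w : List α) (n : ℕ) :
    ((wordPow w n).map f).prod = (w.map f).prod ^ n := by
  induction n with
  | zero => simp [wordPow]
  | succ n ih => rw [wordPow_succ, List.map_append, List.prod_append, ih, pow_succ']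

/-- A nonzero entry of the power with exponent `c.length` would give `w ^ c.length = d ^ w.length`
for a rotation `d` of `c`; both being primitive, `w = d`. -/
theorem isNilpotent_prod_cycleMatrix {c : List (DArrow V)} (M : Matrix (Fin k) (Fin k) S)
    (hc : IsPrimitiveWord c) {w : List (DArrow V)} (hw : IsPrimitiveWord w) (h : ¬ w ~r c) :
    IsNilpotent (w.map (cycleMatrix c M)).prod := by
  refine ⟨c.length, ?_⟩
  rw [← prod_map_wordPow]
  ext1 d d'
  by_contra hne
  obtain ⟨h1, -⟩ := prefix_of_prod_cycleMatrix_ne_zero hne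
  have hd : d.1.length = c.length := d.isRotated.perm.length_eq
  have hc0 : 0 < c.length := List.length_pos_iff.2 hc.1
  have hw0 : 0 < w.length := List.length_pos_iff.2 hw.1
  rw [length_wordPow] at h1
  have h2 : wordPow d.1 w.length <+: wordPow d.1 (c.length * w.length) :=
    wordPow_prefix (Nat.le_mul_of_pos_left _ hc0)
  have h3 : wordPow w c.length = wordPow d.1 w.length :=
    (List.prefix_of_prefix_length_le h1 h2 (by simp [hd, mul_comm])).eq_of_length
      (by simp [hd, mul_comm])
  rw [hw.eq_of_wordPow_eq (hc.of_isRotated d.isRotated) hc0 hw0 h3] at h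
  exact h d.isRotated

/-- By primitivity a walk that has left `c` does not meet `c` again before the cycle closes, so
every edge on the way has weight 1. The induction moves letters from `v` to the end of `u`. -/
theorem prod_cycleMatrix_suffix {c : List (DArrow V)} (hc : IsPrimitiveWord c)
    (v u : List (DArrow V)) (hu : u ≠ []) (huv : c = u ++ v) (d : Rotations c)
    (hd : d.1 = v ++ u) : (v.map (cycleMatrix c M)).prod d (Rotations.base c) = 1 := by
  induction v generalizing u d with
  | nil =>
    have : d = Rotations.base c := Subtype.ext (by simp [hd, huv, Rotations.base])
    rw [this]
    exact Matrix.one_apply_eq _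
  | cons x v ih =>
    have hne : d ≠ Rotations.base c := by
      rintro rfl
      rcases hc.2 _ _ huv hd with h | h
      · exact hu h
      · simp at h
    classical
    rw [List.map_cons, List.prod_cons, cycleMatrix_mul_apply _ _ _ _ (by simp [hd]), if_neg hne,
      one_mul]
    exact ih (u ++ [x]) (by simp) (by simp [huv]) _ (by simp [Rotations.next, hd])

theorem prod_cycleMatrix_self {c : List (DArrow V)} (hc : IsPrimitiveWord c) :
    (c.map (cycleMatrix c M)).prod =
      Matrix.single (Rotations.base c) (Rotations.base c) M := by
  ext1 d d'
  by_cases h : d = Rotations.base c ∧ d' = Rotations.base c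
  · obtain ⟨rfl, rfl⟩ := h
    rw [Matrix.single_apply_same]
    obtain ⟨x, v, hv⟩ := List.exists_cons_of_ne_nil hc.1
    have h1 : (c.map (cycleMatrix c M)).prod =
        cycleMatrix c M x * (v.map (cycleMatrix c M)).prod := by
      rw [← List.prod_cons, ← List.map_cons, ← hv]
    classical
    rw [h1, cycleMatrix_mul_apply _ _ _ _ (by simp [Rotations.base, hv]), if_pos rfl,
      prod_cycleMatrix_suffix M hc v [x] (by simp) hv _ (by simp [Rotations.next, Rotations.base, hv]),
      mul_one]
  · rw [Matrix.single_apply_of_ne _ _ _ _ _ (fun h' => h ⟨h'.1.symm, h'.2.symm⟩)]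
    -- The first `c.length` letters read from `d` spell `d` itself, so a nonzero entry forces `c =
    -- d`, and the walk returns to its start.
    by_contra hne
    obtain ⟨h1, h2⟩ := prefix_of_prod_cycleMatrix_ne_zero hne
    have hl : d.1.length = c.length := d.isRotated.perm.length_eq
    have hc0 : 0 < c.length := List.length_pos_iff.2 hc.1
    have h3 : d.1 <+: wordPow d.1 c.length := by
      simpa [wordPow] using wordPow_prefix (w := d.1) (k := 1) hc0
    have h4 : c = d.1 := (List.prefix_of_prefix_length_le h1 h3 hl.ge).eq_of_length hl.symm
    refine h ⟨Subtype.ext h4.symm, Subtype.ext ?_⟩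
    rw [h2, ← h4, List.rotate_length]
    rfl

/-- The matrix of `x` on the cycle of `c`, with entries in the ground ring. -/
noncomputable def forwardMatrix (x : DArrow V) :
    Matrix (Rotations c × Fin k) (Rotations c × Fin k) S :=
  compRingEquiv (Rotations c) (Fin k) S (cycleMatrix c M x)

/-- The action of a letter on the sum of the cycle of `c` and the dual cycle. -/
noncomputable def dualizedMatrix (x : DArrow V) :
    Matrix (Rotations c × Fin k) (Rotations c × Fin k) S :=
  forwardMatrix c M x + (forwardMatrix c M x.swap)ᵀ

theorem dualizedMatrix_swap (x : DArrow V) :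
    dualizedMatrix c M x.swap = (dualizedMatrix c M x)ᵀ := by
  simp [dualizedMatrix, add_comm]

theorem prod_forwardMatrix (w : List (DArrow V)) : (w.map (forwardMatrix c M)).prod =
    compRingEquiv (Rotations c) (Fin k) S (w.map (cycleMatrix c M)).prod := by
  rw [map_list_prod, List.map_map]
  rfl

theorem prod_transpose_forwardMatrix (w : List (DArrow V)) :
    (w.map fun x => (forwardMatrix c M x.swap)ᵀ).prod =
      ((wordTranspose w).map (forwardMatrix c M)).prodᵀ := by
  rw [Matrix.transpose_list_prod, wordTranspose]
  simp [List.map_reverse, Function.comp_def]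

theorem forwardMatrix_ne_zero {c : List (DArrow V)} {M : Matrix (Fin k) (Fin k) S} {x : DArrow V} {d d' : Rotations c × Fin k}
    (h : forwardMatrix c M x d d' ≠ 0) : d.1.1.head? = some x ∧ d'.1 = d.1.next := by
  refine cycleMatrix_ne_zero (M := M) fun h0 => h ?_
  simp [forwardMatrix, h0]

/-- A nonzero entry needs two edges with a common end. As `next` is injective they start at the same
rotation, whose first letter is both `x` and `y.swap`. -/
theorem forwardMatrix_mul_transpose {x y : DArrow V} (h : y ≠ x.swap) :
    forwardMatrix c M x * (forwardMatrix c M y.swap)ᵀ = 0 := by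
  ext1 d d'
  by_contra hne
  obtain ⟨e, h1, h2⟩ := exists_of_mul_apply_ne_zero hne
  obtain ⟨h3, h4⟩ := forwardMatrix_ne_zero h1
  obtain ⟨h5, h6⟩ := forwardMatrix_ne_zero (show forwardMatrix c M y.swap d' e ≠ 0 from h2)
  rw [Rotations.next_injective (h4.symm.trans h6), h5, Option.some_inj] at h3
  exact h (by rw [← h3, Sum.swap_swap])

/-- Here the two edges share their start, whose first letter would be both `x.swap` and `y`. -/
theorem transpose_mul_forwardMatrix {x y : DArrow V} (h : y ≠ x.swap) :
    (forwardMatrix c M x.swap)ᵀ * forwardMatrix c M y = 0 := by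
  ext1 d d'
  by_contra hne
  obtain ⟨e, h1, h2⟩ := exists_of_mul_apply_ne_zero hne
  obtain ⟨h3, h4⟩ := forwardMatrix_ne_zero (show forwardMatrix c M x.swap e d ≠ 0 from h1)
  obtain ⟨h5, h6⟩ := forwardMatrix_ne_zero h2
  rw [h5, Option.some_inj] at h3
  exact h h3

/-- If consecutive letters annihilate each other, a product of sums is the sum of products. -/
theorem prod_add_of_isChain {α R : Type*} [Semiring R] (f g : α → R) (r : α → α → Prop)
    (hfg : ∀ x y, r x y → f x * g y = 0) (hgf : ∀ x y, r x y → g x * f y = 0)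
    {w : List α} (hw : w.IsChain r) (hne : w ≠ []) :
    (w.map fun x => f x + g x).prod = (w.map f).prod + (w.map g).prod := by
  induction w with
  | nil => exact absurd rfl hne
  | cons x w ih =>
    cases w with
    | nil => simp
    | cons y w =>
      obtain ⟨h1, h2⟩ := List.isChain_cons_cons.1 hw
      have h3 : f x * ((y :: w).map g).prod = 0 := by
        rw [List.map_cons, List.prod_cons, ← mul_assoc, hfg _ _ h1, zero_mul]
      have h4 : g x * ((y :: w).map f).prod = 0 := by
        rw [List.map_cons, List.prod_cons, ← mul_assoc, hgf _ _ h1, zero_mul]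
      rw [List.map_cons, List.prod_cons, ih h2 (by simp), add_mul, mul_add, mul_add, h3, h4,
        add_zero, zero_add]
      simp

theorem revDet_prod_dualizedMatrix {w : List (DArrow V)} (hw : IsReducedWord (w ++ w))
    (hne : w ≠ []) :
    revDet (w.map (dualizedMatrix c M)).prod = revDet (w.map (forwardMatrix c M)).prod *
      revDet ((wordTranspose w).map (forwardMatrix c M)).prod := by
  have h1 := prod_add_of_isChain (forwardMatrix c M) (fun x => (forwardMatrix c M x.swap)ᵀ)
    _ (fun _ _ h => forwardMatrix_mul_transpose c M h)
    (fun _ _ h => transpose_mul_forwardMatrix c M h) (List.isChain_append.1 hw).1 hne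
  -- Reducedness of `w ++ w` covers the passage from the last letter of `w` back to the first, which
  -- kills this product.
  have h2 : (w.map (forwardMatrix c M)).prod *
      (w.map fun x => (forwardMatrix c M x.swap)ᵀ).prod = 0 := by
    obtain ⟨x, v, hx⟩ := List.exists_cons_of_ne_nil hne
    obtain ⟨v', y, hy⟩ := List.eq_nil_or_concat' w |>.resolve_left hne
    have hxy : x ≠ y.swap := (List.isChain_append.1 hw).2.2 y (by simp [hy]) x (by simp [hx])
    have e1 : (w.map (forwardMatrix c M)).prod =
        (v'.map (forwardMatrix c M)).prod * forwardMatrix c M y := by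
      rw [hy, List.map_append, List.prod_append]; simp
    have e2 : (w.map fun x => (forwardMatrix c M x.swap)ᵀ).prod =
        (forwardMatrix c M x.swap)ᵀ * (v.map fun x => (forwardMatrix c M x.swap)ᵀ).prod := by
      rw [hx, List.map_cons, List.prod_cons]
    rw [e1, e2, Matrix.mul_assoc, ← Matrix.mul_assoc (forwardMatrix c M y),
      forwardMatrix_mul_transpose c M hxy, Matrix.zero_mul, Matrix.mul_zero]
  rw [← revDet_transpose (List.prod (List.map _ (wordTranspose w))),
    ← prod_transpose_forwardMatrix, ← revDet_add_of_mul_eq_zero h2, ← h1]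
  rfl

theorem revDet_prod_forwardMatrix_of_not_isRotated [IsDomain S] {c : List (DArrow V)}
    (hc : IsPrimitiveWord c) {w : List (DArrow V)} (hw : IsPrimitiveWord w) (h : ¬ w ~r c) :
    revDet (w.map (forwardMatrix c M)).prod = 1 := by
  rw [prod_forwardMatrix]
  exact revDet_of_isNilpotent
    ((isNilpotent_prod_cycleMatrix M hc hw h).map (compRingEquiv (Rotations c) (Fin k) S))

theorem revDet_prod_forwardMatrix_self {c : List (DArrow V)} (hc : IsPrimitiveWord c) :
    revDet (c.map (forwardMatrix c M)).prod = revDet M := by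
  rw [prod_forwardMatrix, prod_cycleMatrix_self M hc]
  exact revDet_comp_single _ M

end CycleRepresentation

/-! ### Prescribing the polynomials of all classes. -/

section Realization

variable {V : Type*} [Quiver V] {i : V → V} {K : Type*} [Field K]

/-- The matrices of all letters of the double quiver determined by those of the arrows. -/
def letterEval {B : Type*} (A : Arrow V → Matrix B B K) : DArrow V → Matrix B B K :=
  Sum.elim A fun a => (A a)ᵀ

/-- A family of polynomials is realizable if its members are the polynomials `det (1 + λ X_a)`,
for `a` in the `∼`-classes of primitive closed paths, at some tuple of square matrices. -/
def IsRealizable (h : Quotient (primSetoid i) → K[X]) : Prop :=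
  ∃ (N : ℕ) (A : Arrow V → Matrix (Fin (N + 1)) (Fin (N + 1)) K),
    ∀ q, revDet (q.out.1.word.map (letterEval A)).prod = h q

theorem isRealizable_of_fintype {B : Type*} [Fintype B] [DecidableEq B] [Nonempty B]
    (L : DArrow V → Matrix B B K) (hL : ∀ x, L x.swap = (L x)ᵀ)
    {h : Quotient (primSetoid i) → K[X]}
    (hh : ∀ q, revDet (q.out.1.word.map L).prod = h q) : IsRealizable h := by
  obtain ⟨N, hN⟩ := Nat.exists_eq_succ_of_ne_zero (Fintype.card_ne_zero (α := B))
  let e : Fin (N + 1) ≃ B := (finCongr hN.symm).trans (Fintype.equivFin B).symm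
  refine ⟨N, fun a => (L (Sum.inl a)).submatrix e e, fun q => ?_⟩
  have h1 : (letterEval fun a => (L (Sum.inl a)).submatrix e e) =
      fun x => reindexAlgEquiv K K e.symm (L x) := by
    funext x
    cases x with
    | inl a => rfl
    | inr a =>
      have h2 : L (Sum.inr a) = (L (Sum.inl a))ᵀ := hL (Sum.inl a)
      rw [h2]
      rfl
  have h3 : (q.out.1.word.map (letterEval fun a => (L (Sum.inl a)).submatrix e e)).prod =
      (q.out.1.word.map L).prod.submatrix e e := by
    rw [h1]
    exact ((map_list_prod (reindexAlgEquiv K K e.symm) _).trans (by rw [List.map_map]; rfl)).symm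
  rw [h3, revDet_submatrix, hh]

theorem isRealizable_one : IsRealizable (1 : Quotient (primSetoid i) → K[X]) := by
  refine isRealizable_of_fintype (B := Unit) (fun _ => 0) (by simp) fun q => ?_
  obtain ⟨x, v, hx⟩ := List.exists_cons_of_ne_nil q.out.1.ne_nil
  rw [hx, List.map_cons, List.prod_cons, zero_mul, revDet_zero, Pi.one_apply]

theorem letterEval_swap {R B : Type*} (A : Arrow V → Matrix B B R) (x : DArrow V) :
    letterEval A x.swap = (letterEval A x)ᵀ := by
  cases x <;> rfl

theorem prod_map_fromBlocks {α m n : Type*} [Fintype m] [DecidableEq m] [Fintype n]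
    [DecidableEq n] (f : α → Matrix m m K) (g : α → Matrix n n K) (w : List α) :
    (w.map fun x => fromBlocks (f x) 0 0 (g x)).prod =
      fromBlocks (w.map f).prod 0 0 (w.map g).prod := by
  induction w with
  | nil => exact fromBlocks_one.symm
  | cons x w ih => simp [ih, fromBlocks_multiply]

theorem IsRealizable.mul {h h' : Quotient (primSetoid i) → K[X]} (hh : IsRealizable h)
    (hh' : IsRealizable h') : IsRealizable (h * h') := by
  obtain ⟨N, A, hA⟩ := hh
  obtain ⟨N', A', hA'⟩ := hh'
  refine isRealizable_of_fintype
    (fun x => fromBlocks (letterEval A x) 0 0 (letterEval A' x)) (fun x => ?_) fun q => ?_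
  · rw [letterEval_swap, letterEval_swap, fromBlocks_transpose, transpose_zero, transpose_zero]
  · rw [prod_map_fromBlocks, revDet_fromBlocks, hA, hA', Pi.mul_apply]

theorem ClosedPath.isReducedWord_append_self (hfix : ∀ v, i v ≠ v) (a : ClosedPath i) :
    IsReducedWord (a.word ++ a.word) :=
  (isPath_append.2 ⟨_, a.isPath, a.isPath⟩ : IsPath i a.vertex _ a.vertex).isReducedWord hfix

-- The dualized cycle of a representative of `j`, with a companion matrix of `h` as its weight,
-- realizes the family.
open Classical in
theorem isRealizable_mulSingle (hfix : ∀ v, i v ≠ v) (j : Quotient (primSetoid i)) (h : K[X])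
    (h0 : h.coeff 0 = 1) : IsRealizable (Pi.mulSingle j h) := by
  obtain ⟨k, M, hM⟩ := exists_revDet_eq h h0
  -- For `k = 0` the cycle carries the zero space, whereas positive size is required; but then `h =
  -- 1`.
  rcases Nat.eq_zero_or_pos k with rfl | hk
  · rw [revDet_of_isEmpty] at hM
    rw [← hM, Pi.mulSingle_one]
    exact isRealizable_one
  have hc := j.out.2.isPrimitiveWord
  have : Nonempty (Rotations j.out.1.word × Fin k) := ⟨Rotations.base _, ⟨0, hk⟩⟩
  refine isRealizable_of_fintype (dualizedMatrix j.out.1.word M)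
    (dualizedMatrix_swap _ M) fun q => ?_
  have hw := q.out.2.isPrimitiveWord
  have hr := q.out.1.isReducedWord_append_self hfix
  rw [revDet_prod_dualizedMatrix _ M hr hw.1]
  by_cases hq : q = j
  · subst hq
    have hn : ¬ wordTranspose q.out.1.word ~r q.out.1.word := fun h' =>
      IsReducedWord.not_isRotated_wordTranspose (List.isChain_append.1 hr).1 hw.1 h'.symm
    rw [revDet_prod_forwardMatrix_self M hc,
      revDet_prod_forwardMatrix_of_not_isRotated M hc hw.wordTranspose hn, hM, mul_one,
      Pi.mulSingle_eq_same]
  -- For another class neither the word nor its transpose is a rotation of `c`, so both factors are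
  -- 1.
  · have hn : ¬ q.out.1.Equivalent j.out.1 := fun h' => hq <| by
      rw [← Quotient.out_eq q, ← Quotient.out_eq j]
      exact Quotient.sound h'
    have hn' : ¬ wordTranspose q.out.1.word ~r j.out.1.word := fun h' => hn <| Or.inr <| by
      simpa [wordTranspose_wordTranspose] using isRotated_wordTranspose h'
    rw [revDet_prod_forwardMatrix_of_not_isRotated M hc hw fun h' => hn (Or.inl h'),
      revDet_prod_forwardMatrix_of_not_isRotated M hc hw.wordTranspose hn', mul_one,
      Pi.mulSingle_eq_of_ne hq]

/-- Any family of polynomials with constant term one, almost all equal to one, is realizable. -/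
theorem isRealizable_of_eq_one (hfix : ∀ v, i v ≠ v) (J : Finset (Quotient (primSetoid i)))
    (h : Quotient (primSetoid i) → K[X]) (h0 : ∀ q, (h q).coeff 0 = 1)
    (h1 : ∀ q ∉ J, h q = 1) : IsRealizable h := by
  classical
  have : h = ∏ j ∈ J, Pi.mulSingle j (h j) := by
    funext q
    rw [Finset.prod_apply]
    by_cases hq : q ∈ J
    · rw [Finset.prod_eq_single_of_mem q hq fun j _ hj => Pi.mulSingle_eq_of_ne hj.symm _,
        Pi.mulSingle_eq_same]
    · rw [h1 q hq, Finset.prod_eq_one]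
      intro j hj
      exact Pi.mulSingle_eq_of_ne (ne_of_mem_of_not_mem hj hq).symm _
  rw [this]
  refine Finset.prod_induction _ IsRealizable (fun _ _ => IsRealizable.mul) isRealizable_one
    fun j _ => ?_
  convert isRealizable_mulSingle hfix j (h j) (h0 j)

end Realization

/-! ### Evaluating the invariants at square matrices of one size. -/

section Specialization

variable {F : Type*} [Field F] {V : Type*} [Quiver V] {i : V → V} {K : Type*} [Field K]
  [Algebra F K]

/-- The dimension vector with all entries equal to `N`. -/
def constDim (i : V → V) (N : ℕ) : DimVector i := ⟨fun _ => N, fun _ => rfl⟩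

/-- The evaluation of the coordinate ring at a tuple of square matrices. -/
noncomputable def evalAt {N : ℕ} (A : Arrow V → Matrix (Fin N) (Fin N) K) :
    CoordRing F (constDim i N) →ₐ[F] K :=
  MvPolynomial.aeval fun x => A x.1 x.2.1 x.2.2

theorem map_evalAt_letterMatrix {N : ℕ} (A : Arrow V → Matrix (Fin N) (Fin N) K)
    (x : DArrow V) :
    (letterMatrix F (constDim i N) x).map (evalAt A) = letterEval A x := by
  cases x with
  | inl a =>
    ext r s
    exact MvPolynomial.aeval_X _ _
  | inr a =>
    ext r s
    exact MvPolynomial.aeval_X _ _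

theorem map_evalAt_pathMatrix {N : ℕ} (A : Arrow V → Matrix (Fin N) (Fin N) K)
    {w : List (DArrow V)} {u v : V} (h : IsPath i u w v) :
    (pathMatrix F (constDim i N) u w v h).map (evalAt A) = (w.map (letterEval A)).prod := by
  induction w generalizing u with
  | nil =>
    exact Matrix.map_one _ (map_zero _) (map_one _)
  | cons x w ih =>
    rw [List.map_cons, List.prod_cons, ← ih h.2, ← map_evalAt_letterMatrix (F := F) (i := i),
      pathMatrix, Matrix.map_mul]
    rfl

theorem evalAt_sigmaValue {N : ℕ} (A : Arrow V → Matrix (Fin N) (Fin N) K) (t : ℕ)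
    (a : ClosedPath i) : evalAt A (sigmaValue F (constDim i N) t a) =
      (revDet (a.word.map (letterEval A)).prod).coeff t := by
  rw [sigmaValue_eq]
  change evalAt A ((revDet (a.matrix (F := F) (constDim i N))).coeff t) = _
  have h := map_revDet (evalAt A : CoordRing F (constDim i N) →ₐ[F] K).toRingHom
    (a.matrix (F := F) (constDim i N))
  have h' : (a.matrix (F := F) (constDim i N)).map
      (evalAt A : CoordRing F (constDim i N) →ₐ[F] K).toRingHom =
        (a.word.map (letterEval A)).prod := map_evalAt_pathMatrix A a.isPath
  rw [h'] at h
  exact (Polynomial.coeff_map _ t).symm.trans (congrArg (fun p : K[X] => p.coeff t) h)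

theorem evalAt_Upsilon_X (hi : Function.Involutive i) {N : ℕ}
    (A : Arrow V → Matrix (Fin N) (Fin N) K) (x : ℕ+ × Quotient (primSetoid i)) :
    evalAt A (Upsilon F hi (constDim i N) (MvPolynomial.X x)).1 =
      (revDet (x.2.out.1.word.map (letterEval A)).prod).coeff x.1 := by
  obtain ⟨t, q⟩ := x
  rw [← evalAt_sigmaValue (F := F), Upsilon, MvPolynomial.aeval_X]
  -- The value on a class may be computed at the representative `q.out`, the one used in
  -- `IsRealizable`.
  conv_lhs => rw [← Quotient.out_eq q]
  rfl

end Specialization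

/-! ### Free relations vanish. -/

section Independence

variable {F : Type*} [Field F] {V : Type*} [Quiver V] {i : V → V}

open Classical in
/-- The polynomial `1 + ∑ σ_t(q) λ^t`, where the sum is over the pairs `(t, q)` in `s`. -/
noncomputable def sigmaSeries (s : Finset (ℕ+ × Quotient (primSetoid i)))
    (q : Quotient (primSetoid i)) : (FractionRing (NSigma F i))[X] :=
  1 + ∑ x ∈ s, if x.2 = q then
    Polynomial.monomial x.1 (algebraMap (NSigma F i) (FractionRing (NSigma F i))
      (MvPolynomial.X x)) else 0

theorem coeff_sigmaSeries_zero (s : Finset (ℕ+ × Quotient (primSetoid i)))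
    (q : Quotient (primSetoid i)) : (sigmaSeries (F := F) s q).coeff 0 = 1 := by
  rw [sigmaSeries, coeff_add, coeff_one_zero, finsetSum_coeff, Finset.sum_eq_zero, add_zero]
  intro x _
  split_ifs
  · rw [coeff_monomial, if_neg x.1.ne_zero]
  · exact coeff_zero 0

theorem coeff_sigmaSeries {s : Finset (ℕ+ × Quotient (primSetoid i))}
    {x : ℕ+ × Quotient (primSetoid i)} (hx : x ∈ s) : (sigmaSeries (F := F) s x.2).coeff x.1 =
      algebraMap (NSigma F i) (FractionRing (NSigma F i)) (MvPolynomial.X x) := by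
  rw [sigmaSeries, coeff_add, coeff_one, if_neg x.1.ne_zero, zero_add, finsetSum_coeff,
    Finset.sum_eq_single_of_mem x hx, if_pos rfl, coeff_monomial, if_pos rfl]
  intro y _ hy
  split_ifs with h
  · rw [coeff_monomial, if_neg fun h' => hy (Prod.ext (PNat.coe_injective h') h)]
  · exact coeff_zero _

theorem sigmaSeries_eq_one {s : Finset (ℕ+ × Quotient (primSetoid i))}
    {q : Quotient (primSetoid i)} (hq : ∀ x ∈ s, x.2 ≠ q) : sigmaSeries (F := F) s q = 1 := by
  rw [sigmaSeries, Finset.sum_eq_zero fun x hx => if_neg (hq x hx), add_zero]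

theorem eq_zero_of_mem_freeRelations (hi : Function.Involutive i) (hfix : ∀ v, i v ≠ v)
    {f : NSigma F i} (hf : f ∈ freeRelations F hi) : f = 0 := by
  classical
  -- Only finitely many symbols occur in `f`; the matrices give each of them itself as value.
  obtain ⟨N, A, hA⟩ := isRealizable_of_eq_one hfix (f.vars.image Prod.snd)
    (sigmaSeries (F := F) f.vars) (coeff_sigmaSeries_zero f.vars) fun q hq =>
      sigmaSeries_eq_one fun x hx h => hq (Finset.mem_image.2 ⟨x, hx, h⟩)
  have h0 : Upsilon F hi (constDim i (N + 1)) f = 0 := by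
    simp only [freeRelations, Submodule.mem_iInf] at hf
    exact hf (constDim i (N + 1)) fun _ => N.succ_pos
  let ψ : NSigma F i →ₐ[F] FractionRing (NSigma F i) :=
    ((evalAt A).comp (invariants F (constDim i (N + 1))).val).comp (Upsilon F hi _)
  -- Evaluation agrees with the inclusion into the fraction field on constants and on the variables
  -- of `f`, which is enough to determine the value at `f`.
  have h1 : ψ.toRingHom f = algebraMap (NSigma F i) (FractionRing (NSigma F i)) f := by
    refine MvPolynomial.hom_congr_vars (RingHom.ext fun r => ?_) (fun x hx _ => ?_) rfl
    · exact (ψ.commutes r).trans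
        (IsScalarTower.algebraMap_apply F (NSigma F i) (FractionRing (NSigma F i)) r)
    · rw [← coeff_sigmaSeries hx, ← hA]
      exact evalAt_Upsilon_X hi A x
  have h2 : ψ.toRingHom f = 0 := by
    change evalAt A (Upsilon F hi _ f).1 = 0
    rw [h0]
    exact map_zero _
  rw [h2] at h1
  exact (FaithfulSMul.algebraMap_injective (NSigma F i) (FractionRing (NSigma F i)))
    (h1.symm.trans (map_zero _).symm)

end Independence

end MixedQuiver

theorem mainTheorem3 {F : Type*} [Field F] [Infinite F]
    {V : Type*} [Quiver V] [Finite V] [∀ u v : V, Finite (u ⟶ v)]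
    (i : V → V) (hi : Function.Involutive i) (hfix : ∀ v, i v ≠ v) :
    MixedQuiver.freeRelations F hi = ⊥ :=
  (Submodule.eq_bot_iff _).2 fun _ => MixedQuiver.eq_zero_of_mem_freeRelations hi hfix
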